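/- Let $\mu>0$ and let $(A_k)_{k\ge 0}$, $(B_k)_{k\ge 0}$ be two mutually independent sequences of i.i.d. nonnegative random variables, where the $A_k$ are exponentially distributed with rate $\mu$ and the $B_k$ have distribution function $F_B$. Put $\overline F_B=1-F_B$. Let $W_0\ge 0$ be any random variable on the same probability space and let $$W_{k+1}=\max\{0,\,B_{k+1}-A_k-W_k\},\qquad k\ge 0 .$$ Assume that $F_B$ is continuous on $[0,\infty)$ and that there are $n$ and measurable real functions $g_1,\dots,g_n,h_1,\dots,h_n$ on $[0,\infty)$ with $$\overline F_B(x+y)=\sum_{i=1}^n g_i(x)h_i(y)\qquad\text{for all }x,y\ge 0,$$ such that every $h_i$ is bounded on $(0,\infty)$ and $\int_0^\infty|g_i(x)|\,dx<\infty$ for every $i$. Write $\beta(\mu)=\int_0^\infty e^{-\mu x}\overline F_B(x)\,dx$ and $\gamma_i(\mu)=\int_0^\infty e^{-\mu x}g_i(x)\,dx$, and let $\Sigma$ be the following system of $n+1$ linear equations in the real unknowns $\pi_0,c_1,\dots,c_n$: $$\pi_0+\mu\pi_0\,\beta(\mu)+\mu\sum_{i=1}^n c_i\gamma_i(\mu)=1,$$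 $$c_i=\mu\pi_0\int_0^\infty h_i(x)\Bigl(\overline F_B(x)-\mu\int_x^\infty e^{-\mu(s-x)}\overline F_B(s)\,ds\Bigr)dx+\mu\sum_{j=1}^n c_j\int_0^\infty h_i(x)\Bigl(g_j(x)-\mu\int_x^\infty e^{-\mu(s-x)}g_j(s)\,ds\Bigr)dx,\quad i=1,\dots,n .$$ Then $\overline F_B$ is integrable on $[0,\infty)$, all integrals in $\Sigma$ converge absolutely, and $\Sigma$ has at least one solution. There is exactly one stationary law, that is, one law of a random variable $W$ such that $W$ has the same distribution as $\max\{0,B-A-W\}$ for independent $W$, $A\sim A_0$, $B\sim B_0$; the law of $W_k$ converges to it in total variation as $k\to\infty$; and for every solution $(\pi_0,c_1,\dots,c_n)$ of $\Sigma$ this law satisfies $\mathbb P[W=0]=\pi_0$ and $$F_W(x)=\mathbb P[W\le x]=1-e^{\mu x}\int_x^\infty e^{-\mu s}\Bigl(\mu\pi_0\overline F_B(s)+\mu\sum_{i=1}^n c_i g_i(s)\Bigr)ds,\qquad x\ge 0 .$$ -/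

import Mathlib

open MeasureTheory ProbabilityTheory Set Filter Topology

namespace LindleyType

noncomputable section

/-- The tail `1 - F_B` of the distribution function of a law `νB` on the real line. -/
def tail (νB : Measure ℝ) (x : ℝ) : ℝ := 1 - cdf νB x

/-- The decomposition `1 - F_B (x + y) = ∑ i, g i x * h i y` for `x, y ≥ 0`, with measurable
`g i` and `h i`, that defines membership of `F_B` in the class `M`. -/
structure TailDecomposition (νB : Measure ℝ) {n : ℕ} (g h : Fin n → ℝ → ℝ) : Prop where
  measurable_g : ∀ i, Measurable (g i)
  measurable_h : ∀ i, Measurable (h i)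
  tail_add : ∀ x y : ℝ, 0 ≤ x → 0 ≤ y → tail νB (x + y) = ∑ i, g i x * h i y

/-- The Laplace transform of a function on the half-line. -/
def laplace (f : ℝ → ℝ) (s : ℝ) : ℝ := ∫ x in Ioi (0 : ℝ), Real.exp (-s * x) * f x

/-- `f x - μ * ∫_x^∞ e^{-μ (s - x)} f s ds`. -/
def expCorrection (μ : ℝ) (f : ℝ → ℝ) (x : ℝ) : ℝ :=
  f x - μ * ∫ s in Ioi x, Real.exp (-μ * (s - x)) * f s

/-- The linear system of `n + 1` equations in the `n + 1` unknowns `π₀` and `c i`. -/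
structure SolvesSystem (μ : ℝ) (νB : Measure ℝ) {n : ℕ} (g h : Fin n → ℝ → ℝ)
    (π₀ : ℝ) (c : Fin n → ℝ) : Prop where
  normalization :
    π₀ + μ * π₀ * laplace (tail νB) μ + μ * ∑ i, c i * laplace (g i) μ = 1
  coefficients : ∀ i,
    c i = μ * π₀ * (∫ x in Ioi (0 : ℝ), h i x * expCorrection μ (tail νB) x)
      + μ * ∑ j, c j * ∫ x in Ioi (0 : ℝ), h i x * expCorrection μ (g j) x

/-- The function `1 - e^{μ x} ∫_x^∞ e^{-μ s} (μ π₀ (1 - F_B s) + μ ∑ i, c i g i s) ds`. -/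
def waitingCDF (μ : ℝ) (νB : Measure ℝ) {n : ℕ} (g : Fin n → ℝ → ℝ)
    (π₀ : ℝ) (c : Fin n → ℝ) (x : ℝ) : ℝ :=
  1 - Real.exp (μ * x) * ∫ s in Ioi x,
    Real.exp (-μ * s) * (μ * π₀ * tail νB s + μ * ∑ i, c i * g i s)

/-- `ν` is a stationary law of the recursion with service law `νA` and preparation law `νB`:
if `W ∼ ν`, `B ∼ νB`, `A ∼ νA` are independent, then `max {0, B - A - W} ∼ ν`. -/
structure IsStationaryLaw (νA νB ν : Measure ℝ) : Prop where
  isProbabilityMeasure : IsProbabilityMeasure ν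
  map_eq :
    (ν.prod (νB.prod νA)).map (fun p : ℝ × ℝ × ℝ => max 0 (p.2.1 - p.2.2 - p.1)) = ν

/-- `ν` is the limiting law of the random variables `W k`: their laws converge to `ν` in total
variation, that is, uniformly over all Borel sets. -/
def IsLimitingLaw {Ω : Type*} [MeasurableSpace Ω] (P : Measure Ω) (W : ℕ → Ω → ℝ)
    (ν : Measure ℝ) : Prop :=
  ∀ ε : ℝ, 0 < ε → ∃ N : ℕ, ∀ k ≥ N, ∀ S : Set ℝ, MeasurableSet S →
    |P.real (W k ⁻¹' S) - ν.real S| ≤ ε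

end

end LindleyType

/-! Write `T` for the map on laws induced by one step. From any state `w ≥ 0`, the event `B ≤ A`
sends the chain to `0` whatever `w` is. Hence `T m = R m + δ m(univ) • dirac 0` on measures carried
by the half-line, where `R` keeps only the event `A < B` and scales total mass by `r = 1 - δ`, and
`δ > 0` because an exponential variable exceeds any level with positive probability. Two measures of
equal mass receive the same atom, so `T` acts on their difference as `R`, a contraction. This gives
uniqueness (`eq_of_lindley_add_eq`, valid for signed measures written as differences), existence
through a geometric series (`exists_lindley_fixed`) and geometric convergence. An initial state that
may depend on the driving sequences is handled by coupling with the recursion started at `0`: the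
two paths coincide after the first time that `B ≤ A`, and the probability that this has not happened
in `k` steps is `r ^ k`.

For the formula, averaging the decomposed tail over `A` shows that the tail of `T m` depends on `m`
only through its atom at `0` and the integrals of the `h i` over the open half-line
(`lindley_real_Ioi_eq`). A stationary law therefore has an explicit density there, and its atom and
moments solve the system (`exists_solvesSystem`). Conversely, any solution, whatever its signs,
defines a signed measure of mass one with those moments, which `T` fixes; signed uniqueness
identifies it with the stationary law (`eq_of_solvesSystem`). Thus neither positivity of a solution
nor uniqueness of its coefficients has to be proved. -/

namespace LindleyType

noncomputable section

open scoped ENNReal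

/-! ### The one-step map on laws: fixed points and contraction -/

/-- The law of `max {0, B - A - W}` when `W ∼ m` and `(B, A) ∼ ρ` are independent. -/
def lindley (ρ : Measure (ℝ × ℝ)) (m : Measure ℝ) : Measure ℝ :=
  (m.prod ρ).map (fun p : ℝ × ℝ × ℝ => max 0 (p.2.1 - p.2.2 - p.1))

/-- The restriction of a law of `(B, A)` to the event `A < B`. -/
def overtake (ρ : Measure (ℝ × ℝ)) : Measure (ℝ × ℝ) := ρ.restrict {p | p.2 < p.1}

lemma measurable_lindleyMap :
    Measurable (fun p : ℝ × ℝ × ℝ => max 0 (p.2.1 - p.2.2 - p.1)) := by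
  fun_prop

lemma measurableSet_overtake : MeasurableSet {p : ℝ × ℝ | p.2 < p.1} :=
  measurableSet_lt measurable_snd measurable_fst

instance (ρ : Measure (ℝ × ℝ)) [IsFiniteMeasure ρ] : IsFiniteMeasure (overtake ρ) := by
  unfold overtake; infer_instance

instance (ρ : Measure (ℝ × ℝ)) [IsFiniteMeasure ρ] (m : Measure ℝ) [IsFiniteMeasure m] :
    IsFiniteMeasure (lindley ρ m) := by
  unfold lindley; infer_instance

variable {ρ : Measure (ℝ × ℝ)}

lemma lindley_univ [IsFiniteMeasure ρ] (m : Measure ℝ) [IsFiniteMeasure m] :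
    lindley ρ m univ = ρ univ * m univ := by
  rw [lindley, Measure.map_apply measurable_lindleyMap MeasurableSet.univ, preimage_univ,
    ← univ_prod_univ, Measure.prod_prod, mul_comm]

lemma lindley_Iio (m : Measure ℝ) : lindley ρ m (Iio 0) = 0 := by
  rw [lindley, Measure.map_apply measurable_lindleyMap measurableSet_Iio]
  have : (fun p : ℝ × ℝ × ℝ => max 0 (p.2.1 - p.2.2 - p.1)) ⁻¹' Iio 0 = ∅ := by
    ext p
    simp
  rw [this, measure_empty]

lemma lindley_add [IsFiniteMeasure ρ] (a b : Measure ℝ) [IsFiniteMeasure a] [IsFiniteMeasure b] :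
    lindley ρ (a + b) = lindley ρ a + lindley ρ b := by
  rw [lindley, Measure.add_prod, Measure.map_add _ _ measurable_lindleyMap]; rfl

lemma lindley_smul [IsFiniteMeasure ρ] (c : ℝ≥0∞) (a : Measure ℝ) : lindley ρ (c • a) = c • lindley ρ a := by
  rw [lindley, Measure.prod_smul_left, Measure.map_smul]; rfl

lemma lindley_sum [IsFiniteMeasure ρ] (m : ℕ → Measure ℝ) :
    lindley ρ (Measure.sum m) = Measure.sum fun k => lindley ρ (m k) := by
  rw [lindley, Measure.prod_sum_left, Measure.map_sum measurable_lindleyMap.aemeasurable]; rfl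

/-- From a state `w ≥ 0`, the recursion jumps to `0` whenever `B ≤ A`. -/
lemma lindley_eq_add_dirac [IsFiniteMeasure ρ] (m : Measure ℝ) [IsFiniteMeasure m] (hm : m (Iio 0) = 0) :
    lindley ρ m = lindley (overtake ρ) m
      + (ρ {p | p.2 < p.1}ᶜ * m univ) • Measure.dirac 0 := by
  have hsplit : ρ = overtake ρ + ρ.restrict {p | p.2 < p.1}ᶜ :=
    (Measure.restrict_add_restrict_compl measurableSet_overtake).symm
  conv_lhs => rw [lindley, hsplit, Measure.prod_add, Measure.map_add _ _ measurable_lindleyMap]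
  congr 1
  have h1 : ∀ᵐ w ∂m, 0 ≤ w := by
    rw [ae_iff]; simp only [not_le]; exact hm
  have h2 : ∀ᵐ p ∂(ρ.restrict {p : ℝ × ℝ | p.2 < p.1}ᶜ), p.1 ≤ p.2 := by
    filter_upwards [ae_restrict_mem measurableSet_overtake.compl] with p hp
    simpa using hp
  have h3 : ∀ᵐ p ∂(m.prod (ρ.restrict {p : ℝ × ℝ | p.2 < p.1}ᶜ)), 0 ≤ p.1 ∧ p.2.1 ≤ p.2.2 :=
    (Measure.quasiMeasurePreserving_fst.ae h1).and (Measure.quasiMeasurePreserving_snd.ae h2)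
  rw [Measure.map_congr (g := fun _ => (0 : ℝ))
    (h3.mono fun p hp => max_eq_left (by linarith [hp.1, hp.2])), Measure.map_const,
    ← univ_prod_univ, Measure.prod_prod, Measure.restrict_apply_univ, mul_comm]

instance [IsFiniteMeasure ρ] (m : Measure ℝ) [IsFiniteMeasure m] (k : ℕ) :
    IsFiniteMeasure ((lindley ρ)^[k] m) := by
  induction k with
  | zero => simpa
  | succ k ih => rw [Function.iterate_succ_apply']; infer_instance

lemma lindley_iterate_univ [IsFiniteMeasure ρ] (m : Measure ℝ) [IsFiniteMeasure m] (k : ℕ) :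
    (lindley ρ)^[k] m univ = ρ univ ^ k * m univ := by
  induction k with
  | zero => simp
  | succ k ih => rw [Function.iterate_succ_apply', lindley_univ, ih, pow_succ, ← mul_assoc,
      mul_comm (ρ univ)]

lemma overtake_univ_lt_one [IsProbabilityMeasure ρ] (hρ : ρ {p | p.2 < p.1}ᶜ ≠ 0) :
    overtake ρ univ < 1 := by
  rw [overtake, Measure.restrict_apply_univ]
  refine lt_of_le_of_ne prob_le_one fun h => hρ ?_
  rwa [prob_compl_eq_zero_iff measurableSet_overtake]

/-- Two finite measures of equal mass on the half-line whose difference is fixed by the recursion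
are equal. -/
lemma eq_of_lindley_add_eq [IsProbabilityMeasure ρ] (hρ : ρ {p | p.2 < p.1}ᶜ ≠ 0)
    (a b : Measure ℝ) [IsFiniteMeasure a] [IsFiniteMeasure b] (ha : a (Iio 0) = 0)
    (hb : b (Iio 0) = 0) (hab : a univ = b univ) (h : lindley ρ a + b = lindley ρ b + a) :
    a = b := by
  have key : ∀ (a b : Measure ℝ) [IsFiniteMeasure a] [IsFiniteMeasure b], a (Iio 0) = 0 →
      b (Iio 0) = 0 → a univ = b univ → lindley ρ a + b = lindley ρ b + a → a ≤ b := by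
    intro a b _ _ ha hb hab h
    -- Equal masses produce equal reset atoms, which cancel: the difference `a - b` is fixed by the
    -- contraction `R` as well. Sums replace differences because measures have no subtraction suited
    -- to signed values.
    have h1 : lindley (overtake ρ) a + b = lindley (overtake ρ) b + a := by
      rw [lindley_eq_add_dirac a ha, lindley_eq_add_dirac b hb, hab, add_right_comm,
        add_right_comm _ _ a] at h
      have : IsFiniteMeasure
          ((ρ {p | p.2 < p.1}ᶜ * b univ) • (Measure.dirac 0 : Measure ℝ)) :=
        Measure.smul_finite _ (ENNReal.mul_ne_top (measure_ne_top _ _) (measure_ne_top _ _))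
      exact (Measure.add_left_inj _ _ _).1 h
    have h2 : ∀ k, (lindley (overtake ρ))^[k] a + b = (lindley (overtake ρ))^[k] b + a := by
      intro k
      induction k with
      | zero => simp [add_comm]
      | succ k ih =>
        have h3 := congrArg (lindley (overtake ρ)) ih
        rw [lindley_add, lindley_add] at h3
        rw [← Measure.add_left_inj (lindley (overtake ρ) b), Function.iterate_succ_apply',
          Function.iterate_succ_apply', add_right_comm, h3, add_assoc, h1, add_assoc,
          add_comm a]
    refine Measure.le_iff.2 fun S _ => ?_
    have h3 : ∀ k, a S ≤ overtake ρ univ ^ k * a univ + b S := by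
      intro k
      have h4 := congrArg (fun m : Measure ℝ => m S) (h2 k)
      simp only [Measure.add_apply] at h4
      calc a S ≤ _ := le_add_self
        _ = _ := h4.symm
        _ ≤ _ := by
          gcongr
          rw [← lindley_iterate_univ]
          exact measure_mono (subset_univ S)
    have h5 : Tendsto (fun k => overtake ρ univ ^ k * a univ + b S) atTop (𝓝 (0 * a univ + b S)) :=
      (ENNReal.Tendsto.mul_const (ENNReal.tendsto_pow_atTop_nhds_zero_of_lt_one
        (overtake_univ_lt_one hρ)) (Or.inr (measure_ne_top _ _))).add_const _
    rw [zero_mul, zero_add] at h5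
    exact ge_of_tendsto' h5 h3
  exact le_antisymm (key a b ha hb hab h) (key b a hb ha hab.symm h.symm)

/-- Decomposing by the time since the last reset suggests `ν = δ ∑ R^k (dirac 0)`. Its mass is `δ /
(1 - r) = 1`; applying `R` shifts the series, and the reset atom restores the term `k = 0`. -/
lemma exists_lindley_fixed [IsProbabilityMeasure ρ] (hρ : ρ {p | p.2 < p.1}ᶜ ≠ 0) :
    ∃ ν : Measure ℝ, IsProbabilityMeasure ν ∧ ν (Iio 0) = 0 ∧ lindley ρ ν = ν := by
  set δ := ρ {p | p.2 < p.1}ᶜ with hδ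
  set R := lindley (overtake ρ) with hR
  set ν : Measure ℝ := δ • Measure.sum fun k => R^[k] (Measure.dirac 0) with hν
  have hδr : 1 - overtake ρ univ = δ := by
    rw [hδ, overtake, Measure.restrict_apply_univ, prob_compl_eq_one_sub measurableSet_overtake]
  have h1 : ν univ = 1 := by
    rw [hν, Measure.smul_apply, Measure.sum_apply _ MeasurableSet.univ]
    simp_rw [hR, lindley_iterate_univ, measure_univ, mul_one]
    rw [ENNReal.tsum_geometric, hδr, smul_eq_mul, ENNReal.mul_inv_cancel hρ (measure_ne_top _ _)]
  have : IsProbabilityMeasure ν := ⟨h1⟩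
  have h0 : ν (Iio 0) = 0 := by
    rw [hν, Measure.smul_apply, Measure.sum_apply _ measurableSet_Iio]
    have : ∀ k, R^[k] (Measure.dirac 0) (Iio 0) = 0 := by
      intro k
      cases k with
      | zero => simp
      | succ k => rw [Function.iterate_succ_apply', hR, lindley_Iio]
    simp [this]
  refine ⟨ν, this, h0, ?_⟩
  rw [lindley_eq_add_dirac ν h0, h1, mul_one, ← hδ, hν, lindley_smul, lindley_sum, ← smul_add]
  congr 1
  ext S hS
  rw [Measure.add_apply, Measure.sum_apply _ hS, Measure.sum_apply _ hS, add_comm]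
  conv_rhs => rw [tsum_eq_zero_add' ENNReal.summable]
  simp only [Function.iterate_succ_apply', Function.iterate_zero, id, hR]

/-- The laws of the recursion approach a stationary law geometrically. -/
lemma abs_lindley_iterate_sub_le [IsProbabilityMeasure ρ] (ν m : Measure ℝ)
    [IsProbabilityMeasure ν] [IsProbabilityMeasure m] (hν : ν (Iio 0) = 0)
    (hm : m (Iio 0) = 0) (hfix : lindley ρ ν = ν) (k : ℕ) (S : Set ℝ) :
    |((lindley ρ)^[k] m).real S - ν.real S| ≤ (overtake ρ univ).toReal ^ k := by
  have h1 : ∀ k, (lindley ρ)^[k] m (Iio 0) = 0 := by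
    intro k
    cases k with
    | zero => simpa
    | succ k => rw [Function.iterate_succ_apply', lindley_Iio]
  -- This is `T^k m - ν = R^k m - R^k ν`, so the error is a difference of two nonnegative numbers,
  -- each at most `r ^ k`.
  have h2 : ∀ k, (lindley ρ)^[k] m + (lindley (overtake ρ))^[k] ν
      = ν + (lindley (overtake ρ))^[k] m := by
    intro k
    induction k with
    | zero => simp [add_comm]
    | succ k ih =>
      have h3 := congrArg (lindley (overtake ρ)) ih
      rw [lindley_add, lindley_add] at h3
      simp only [Function.iterate_succ_apply']
      rw [lindley_eq_add_dirac _ (h1 k), lindley_iterate_univ, add_right_comm, h3]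
      conv_rhs => rw [← hfix, lindley_eq_add_dirac _ hν]
      simp only [measure_univ, one_pow, mul_one]
      rw [add_right_comm]
  have h3 := congrArg (fun m : Measure ℝ => m.real S) (h2 k)
  beta_reduce at h3
  rw [measureReal_add_apply, measureReal_add_apply] at h3
  have h4 : ∀ (m : Measure ℝ) [IsProbabilityMeasure m],
      ((lindley (overtake ρ))^[k] m).real S ≤ (overtake ρ univ).toReal ^ k := by
    intro m _
    calc _ ≤ ((lindley (overtake ρ))^[k] m).real univ := measureReal_mono (subset_univ S)
      _ = _ := by rw [measureReal_def, lindley_iterate_univ]; simp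
  have := h4 ν
  have := h4 m
  have : 0 ≤ ((lindley (overtake ρ))^[k] ν).real S := measureReal_nonneg
  have : 0 ≤ ((lindley (overtake ρ))^[k] m).real S := measureReal_nonneg
  rw [abs_le]
  constructor <;> linarith

/-! ### Coupling with the recursion started at zero -/

/-- The recursion started at `0`. -/
def recursion {Ω : Type*} (A B : ℕ → Ω → ℝ) : ℕ → Ω → ℝ
  | 0, _ => 0
  | k + 1, ω => max 0 (B (k + 1) ω - A k ω - recursion A B k ω)

/-- The information carried by `A j`, `j < k`, and `B j`, `j ≤ k`. -/
abbrev past {Ω : Type*} (A B : ℕ → Ω → ℝ) (k : ℕ) : MeasurableSpace Ω :=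
  ⨆ i ∈ {i : ℕ ⊕ ℕ | Sum.elim (· < k) (· ≤ k) i},
    MeasurableSpace.comap (Sum.elim A B i) inferInstance

/-- No jump to `0` takes place before time `k`. -/
def noReset {Ω : Type*} (A B : ℕ → Ω → ℝ) (k : ℕ) : Set Ω :=
  {ω | ∀ j < k, A j ω < B (j + 1) ω}

section

variable {Ω : Type*} {A B : ℕ → Ω → ℝ}

lemma past_mono {k l : ℕ} (hkl : k ≤ l) : past A B k ≤ past A B l := by
  refine biSup_mono fun i hi => ?_
  rcases i with i | i <;> simp only [mem_ofPred_eq, Sum.elim_inl, Sum.elim_inr] at hi ⊢ <;> omega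

lemma measurable_past_left (k : ℕ) : Measurable[past A B (k + 1)] (A k) := by
  refine Measurable.mono (comap_measurable (A k)) ?_ le_rfl
  exact le_biSup (fun i => MeasurableSpace.comap (Sum.elim A B i) inferInstance)
    (i := Sum.inl k) (by simp)

lemma measurable_past_right (k : ℕ) : Measurable[past A B k] (B k) := by
  refine Measurable.mono (comap_measurable (B k)) ?_ le_rfl
  exact le_biSup (fun i => MeasurableSpace.comap (Sum.elim A B i) inferInstance)
    (i := Sum.inr k) (by simp)

lemma measurable_past_recursion (k : ℕ) : Measurable[past A B k] (recursion A B k) := by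
  induction k with
  | zero => exact measurable_const
  | succ k ih =>
    have h1 := measurable_past_left (A := A) (B := B) k
    have h2 := measurable_past_right (A := A) (B := B) (k + 1)
    have h3 := ih.mono (past_mono (A := A) (B := B) k.le_succ) le_rfl
    exact measurable_const.max ((h2.sub h1).sub h3)

lemma noReset_succ (k : ℕ) :
    noReset A B (k + 1) = noReset A B k ∩ {ω | A k ω < B (k + 1) ω} := by
  ext ω
  simp only [noReset, mem_ofPred_eq, mem_inter_iff, Nat.lt_succ_iff_lt_or_eq, or_imp, forall_and,
    forall_eq]

lemma measurableSet_past_noReset (k : ℕ) : MeasurableSet[past A B k] (noReset A B k) := by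
  induction k with
  | zero => simp [noReset]
  | succ k ih =>
    rw [noReset_succ]
    refine MeasurableSet.inter (past_mono k.le_succ _ ih) ?_
    exact @measurableSet_lt _ _ _ _ _ (past A B (k + 1)) _ _ _ _ _ (measurable_past_left k)
      (measurable_past_right (k + 1))

/-- When `B (j + 1) ≤ A j`, both nonnegative paths land on `0`; from then on they obey the same
recursion with the same inputs. -/
lemma eq_recursion_of_reset {W : ℕ → Ω → ℝ}
    (h_rec : ∀ k ω, W (k + 1) ω = max 0 (B (k + 1) ω - A k ω - W k ω)) {ω : Ω}
    (hω : 0 ≤ W 0 ω) (k : ℕ) (hk : ω ∉ noReset A B k) : W k ω = recursion A B k ω := by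
  induction k with
  | zero => simp [noReset] at hk
  | succ k ih =>
    rw [noReset_succ] at hk
    by_cases h : ω ∈ noReset A B k
    · have h1 : B (k + 1) ω ≤ A k ω := by
        by_contra h2
        exact hk ⟨h, not_le.1 h2⟩
      have h2 : 0 ≤ W k ω := by
        cases k with
        | zero => exact hω
        | succ k => rw [h_rec]; exact le_max_left _ _
      have h3 : 0 ≤ recursion A B k ω := by
        cases k with
        | zero => exact le_rfl
        | succ k => exact le_max_left _ _
      rw [h_rec, recursion, max_eq_left (by linarith), max_eq_left (by linarith)]
    · rw [h_rec, recursion, ih h]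

variable [MeasurableSpace Ω] {P : Measure Ω}

lemma past_le (hA : ∀ k, Measurable (A k)) (hB : ∀ k, Measurable (B k)) (k : ℕ) :
    past A B k ≤ ‹MeasurableSpace Ω› := by
  refine iSup₂_le fun i _ => ?_
  rcases i with i | i
  · exact (hA i).comap_le
  · exact (hB i).comap_le

/-- `B (k + 1)` and `A k` are independent of the past. -/
lemma indep_past (hA : ∀ k, Measurable (A k)) (hB : ∀ k, Measurable (B k))
    (h_indep : iIndepFun (Sum.elim A B) P) (k : ℕ) :
    Indep (past A B k)
      (MeasurableSpace.comap (fun ω => (B (k + 1) ω, A k ω)) inferInstance) P := by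
  have h1 : ∀ i, MeasurableSpace.comap (Sum.elim A B i) inferInstance ≤ ‹MeasurableSpace Ω› := by
    intro i
    rcases i with i | i
    · exact (hA i).comap_le
    · exact (hB i).comap_le
  have h2 : Disjoint {i : ℕ ⊕ ℕ | Sum.elim (· < k) (· ≤ k) i} {Sum.inl k, Sum.inr (k + 1)} := by
    rw [Set.disjoint_left]
    rintro (i | i) hi
    · simp only [mem_ofPred_eq, Sum.elim_inl] at hi
      simpa using hi.ne
    · simp only [mem_ofPred_eq, Sum.elim_inr] at hi
      simp
      omega
  refine indep_of_indep_of_le_right (indep_iSup_of_disjoint h1 h_indep h2) ?_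
  have h3 : ∀ i ∈ ({Sum.inl k, Sum.inr (k + 1)} : Set (ℕ ⊕ ℕ)),
      Measurable[⨆ i ∈ ({Sum.inl k, Sum.inr (k + 1)} : Set (ℕ ⊕ ℕ)),
        MeasurableSpace.comap (Sum.elim A B i) inferInstance] (Sum.elim A B i) := fun i hi =>
    Measurable.mono (comap_measurable _)
      (le_biSup (fun i => MeasurableSpace.comap (Sum.elim A B i) inferInstance) hi) le_rfl
  refine Measurable.comap_le ?_
  exact Measurable.prodMk (h3 (Sum.inr (k + 1)) (by simp)) (h3 (Sum.inl k) (by simp))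

lemma map_prodMk_eq [IsProbabilityMeasure P]
    (hA : ∀ k, Measurable (A k)) (hB : ∀ k, Measurable (B k))
    (h_indep : iIndepFun (Sum.elim A B) P) {νA νB : Measure ℝ}
    (hA_law : ∀ k, P.map (A k) = νA) (hB_law : ∀ k, P.map (B k) = νB) (k : ℕ) :
    P.map (fun ω => (B (k + 1) ω, A k ω)) = νB.prod νA := by
  have h : IndepFun (B (k + 1)) (A k) P :=
    h_indep.indepFun (i := Sum.inr (k + 1)) (j := Sum.inl k) (by simp)
  rw [(indepFun_iff_map_prod_eq_prod_map_map (hB _).aemeasurable (hA _).aemeasurable).1 h,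
    hA_law, hB_law]

lemma map_recursion [IsProbabilityMeasure P]
    (hA : ∀ k, Measurable (A k)) (hB : ∀ k, Measurable (B k))
    (h_indep : iIndepFun (Sum.elim A B) P) {νA νB : Measure ℝ}
    (hA_law : ∀ k, P.map (A k) = νA) (hB_law : ∀ k, P.map (B k) = νB) (k : ℕ) :
    P.map (recursion A B k) = (lindley (νB.prod νA))^[k] (Measure.dirac 0) := by
  induction k with
  | zero =>
    change P.map (fun _ => (0 : ℝ)) = _
    simp [Measure.map_const]
  | succ k ih =>
    have h1 : Measurable (recursion A B k) :=
      (measurable_past_recursion k).mono (past_le hA hB k) le_rfl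
    have h2 : IndepFun (recursion A B k) (fun ω => (B (k + 1) ω, A k ω)) P :=
      (IndepFun_iff_Indep _ _ _).2 (indep_of_indep_of_le_left (indep_past hA hB h_indep k)
        (measurable_past_recursion k).comap_le)
    have h3 : Measurable fun ω => (B (k + 1) ω, A k ω) := (hB _).prodMk (hA _)
    rw [indepFun_iff_map_prod_eq_prod_map_map h1.aemeasurable h3.aemeasurable, ih,
      map_prodMk_eq hA hB h_indep hA_law hB_law] at h2
    rw [Function.iterate_succ_apply', lindley, ← h2, Measure.map_map measurable_lindleyMap
      (h1.prodMk h3)]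
    rfl

lemma measure_noReset [IsProbabilityMeasure P]
    (hA : ∀ k, Measurable (A k)) (hB : ∀ k, Measurable (B k))
    (h_indep : iIndepFun (Sum.elim A B) P) {νA νB : Measure ℝ}
    (hA_law : ∀ k, P.map (A k) = νA) (hB_law : ∀ k, P.map (B k) = νB) (k : ℕ) :
    P (noReset A B k) = overtake (νB.prod νA) univ ^ k := by
  induction k with
  | zero => simp [noReset]
  | succ k ih =>
    have h1 : {ω | A k ω < B (k + 1) ω}
        = (fun ω => (B (k + 1) ω, A k ω)) ⁻¹' {p | p.2 < p.1} := rfl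
    have h2 := (Indep_iff _ _ _).1 (indep_past hA hB h_indep k) (noReset A B k)
      {ω | A k ω < B (k + 1) ω} (measurableSet_past_noReset k) ⟨_, measurableSet_overtake, rfl⟩
    rw [noReset_succ, h2, ih, pow_succ, h1,
      ← Measure.map_apply ((hB _).prodMk (hA _)) measurableSet_overtake,
      map_prodMk_eq hA hB h_indep hA_law hB_law, overtake, Measure.restrict_apply_univ]

/-- The laws of any solution of the recursion converge in total variation to a stationary law,
whatever the dependence of the initial state on the driving sequences. -/
lemma isLimitingLaw_of_lindley_fixed [IsProbabilityMeasure P] {W : ℕ → Ω → ℝ}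
    (hA : ∀ k, Measurable (A k)) (hB : ∀ k, Measurable (B k))
    (hW_nonneg : ∀ᵐ ω ∂P, 0 ≤ W 0 ω)
    (h_indep : iIndepFun (Sum.elim A B) P) {νA νB ν : Measure ℝ} [IsProbabilityMeasure νA]
    [IsProbabilityMeasure νB] [IsProbabilityMeasure ν]
    (hA_law : ∀ k, P.map (A k) = νA) (hB_law : ∀ k, P.map (B k) = νB)
    (h_rec : ∀ k ω, W (k + 1) ω = max 0 (B (k + 1) ω - A k ω - W k ω))
    (hρ : νB.prod νA {p | p.2 < p.1}ᶜ ≠ 0) (hν : ν (Iio 0) = 0)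
    (hfix : lindley (νB.prod νA) ν = ν) : IsLimitingLaw P W ν := by
  intro ε hε
  set r := (overtake (νB.prod νA) univ).toReal with hr
  have hr1 : r < 1 := by
    have := overtake_univ_lt_one hρ
    rw [hr, ← ENNReal.toReal_one]
    exact (ENNReal.toReal_lt_toReal (measure_ne_top _ _) ENNReal.one_ne_top).2 this
  -- One `r ^ k` bounds the failure of the coupling, the other the distance of the recursion started
  -- at `0` from `ν`.
  have hlim : Tendsto (fun k => 2 * r ^ k) atTop (𝓝 (2 * 0)) :=
    (tendsto_pow_atTop_nhds_zero_of_lt_one ENNReal.toReal_nonneg hr1).const_mul 2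
  rw [mul_zero] at hlim
  obtain ⟨N, hN⟩ := eventually_atTop.1 (hlim.eventually_le_const hε)
  refine ⟨N, fun k hk S hS => le_trans ?_ (hN k hk)⟩
  have h1 : P.real (noReset A B k) = r ^ k := by
    rw [measureReal_def, measure_noReset hA hB h_indep hA_law hB_law, ENNReal.toReal_pow]
  have h2 : P.real (recursion A B k ⁻¹' S)
      = ((lindley (νB.prod νA))^[k] (Measure.dirac 0)).real S := by
    rw [← map_recursion hA hB h_indep hA_law hB_law, map_measureReal_apply
      ((measurable_past_recursion k).mono (past_le hA hB k) le_rfl) hS]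
  have h3 := abs_lindley_iterate_sub_le ν (Measure.dirac 0) hν (by simp) hfix k S
  rw [← h2] at h3
  have h4 : ∀ᵐ ω ∂P, ω ∉ noReset A B k → W k ω = recursion A B k ω :=
    hW_nonneg.mono fun ω hω => eq_recursion_of_reset h_rec hω k
  have h5 : P.real (W k ⁻¹' S) ≤ P.real (recursion A B k ⁻¹' S) + r ^ k := by
    rw [← h1]
    refine le_trans (ENNReal.toReal_mono (measure_ne_top _ _) (measure_mono_ae ?_))
      (measureReal_union_le _ _)
    filter_upwards [h4] with ω hω (hS : W k ω ∈ S)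
    by_cases h : ω ∈ noReset A B k
    · exact Or.inr h
    · exact Or.inl (by rwa [mem_preimage, ← hω h])
  have h6 : P.real (recursion A B k ⁻¹' S) ≤ P.real (W k ⁻¹' S) + r ^ k := by
    rw [← h1]
    refine le_trans (ENNReal.toReal_mono (measure_ne_top _ _) (measure_mono_ae ?_))
      (measureReal_union_le _ _)
    filter_upwards [h4] with ω hω (hS : recursion A B k ω ∈ S)
    by_cases h : ω ∈ noReset A B k
    · exact Or.inr h
    · exact Or.inl (by rwa [mem_preimage, hω h])
  rw [abs_le] at h3 ⊢
  constructor <;> linarith [h3.1, h3.2]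

end

/-! ### Exponential discounting and averages over the exponential law -/

/-- The exponentially discounted integral `∫_x^∞ e^{-μ (s - x)} f s ds`. -/
def discount (μ : ℝ) (f : ℝ → ℝ) (x : ℝ) : ℝ :=
  ∫ s in Ioi x, Real.exp (-μ * (s - x)) * f s

section

variable {μ : ℝ} {f : ℝ → ℝ}

lemma integrableOn_exp_mul (hμ : 0 < μ) {x : ℝ} (hf : IntegrableOn f (Ioi x)) :
    IntegrableOn (fun s => Real.exp (-μ * (s - x)) * f s) (Ioi x) := by
  refine Integrable.bdd_mul (c := 1) hf (by fun_prop) ?_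
  filter_upwards [ae_restrict_mem measurableSet_Ioi] with s hs
  rw [Real.norm_eq_abs, Real.abs_exp, Real.exp_le_one_iff]
  have : 0 < s - x := sub_pos.2 hs
  nlinarith

lemma integral_exp_Ioo (hμ : 0 < μ) {x s : ℝ} (hxs : x < s) :
    ∫ t in Ioo x s, Real.exp (-μ * (s - t)) = (1 - Real.exp (-μ * (s - x))) / μ := by
  rw [← integral_Ioc_eq_integral_Ioo, ← intervalIntegral.integral_of_le hxs.le,
    intervalIntegral.integral_eq_sub_of_hasDerivAt
      (f := fun t => Real.exp (-μ * (s - t)) / μ)]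
  · simp [sub_div]
  · intro t _
    have h1 : HasDerivAt (fun t => -μ * (s - t)) μ t := by
      simpa using ((hasDerivAt_id t).const_sub s).const_mul (-μ)
    simpa [mul_div_assoc, hμ.ne'] using h1.exp.div_const μ
  · exact Continuous.intervalIntegrable (by fun_prop) _ _

lemma integral_indicator_Iio (hμ : 0 < μ) {x s : ℝ} (hxs : x < s) (f : ℝ → ℝ) :
    ∫ t in Ioi x, (Ioi t).indicator (fun s => Real.exp (-μ * (s - t)) * f s) s
      = (1 - Real.exp (-μ * (s - x))) / μ * f s := by
  have h1 : ∀ t, (Ioi t).indicator (fun s => Real.exp (-μ * (s - t)) * f s) s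
      = (Iio s).indicator (fun t => Real.exp (-μ * (s - t)) * f s) t := by
    intro t
    by_cases h : t < s
    · rw [indicator_of_mem (mem_Ioi.2 h), indicator_of_mem (mem_Iio.2 h)]
    · rw [indicator_of_notMem (by simpa using h), indicator_of_notMem (by simpa using h)]
  simp_rw [h1]
  rw [setIntegral_indicator measurableSet_Iio, Ioi_inter_Iio, integral_mul_const,
    integral_exp_Ioo hμ hxs]

/-- The indicator encodes the triangle `x < t < s`; absolute integrability there licenses the
exchange of integrals in `setIntegral_discount`. -/
lemma integrable_discount_kernel (hμ : 0 < μ) (hfm : Measurable f) {x : ℝ}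
    (hf : IntegrableOn f (Ioi x)) :
    Integrable (Function.uncurry fun t s : ℝ =>
      (Ioi t).indicator (fun s => Real.exp (-μ * (s - t)) * f s) s)
      ((volume.restrict (Ioi x)).prod (volume.restrict (Ioi x))) := by
  have hmeas : Measurable (Function.uncurry fun t s : ℝ =>
      (Ioi t).indicator (fun s => Real.exp (-μ * (s - t)) * f s) s) := by
    have : (Function.uncurry fun t s : ℝ =>
        (Ioi t).indicator (fun s => Real.exp (-μ * (s - t)) * f s) s)
        = {p : ℝ × ℝ | p.1 < p.2}.indicator
          (fun p => Real.exp (-μ * (p.2 - p.1)) * f p.2) := by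
      ext ⟨t, s⟩
      simp only [Function.uncurry, indicator_apply, mem_Ioi, mem_ofPred_eq]
    rw [this]
    exact Measurable.indicator (by fun_prop) (measurableSet_lt measurable_fst measurable_snd)
  rw [integrable_prod_iff' hmeas.aestronglyMeasurable]
  constructor
  · filter_upwards [ae_restrict_mem measurableSet_Ioi] with s hs
    have h1 : (fun t => Function.uncurry (fun t s : ℝ =>
        (Ioi t).indicator (fun s => Real.exp (-μ * (s - t)) * f s) s) (t, s))
        = (Iio s).indicator (fun t => Real.exp (-μ * (s - t)) * f s) := by
      ext t
      simp only [Function.uncurry, indicator_apply, mem_Ioi, mem_Iio]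
    rw [h1, integrable_indicator_iff measurableSet_Iio, IntegrableOn,
      Measure.restrict_restrict measurableSet_Iio, Iio_inter_Ioi]
    refine Integrable.mul_const ?_ _
    exact ((Continuous.integrableOn_Icc (by fun_prop)).mono_set Ioo_subset_Icc_self)
  · have h2 : Integrable (fun s => (1 - Real.exp (-μ * (s - x))) / μ * |f s|)
        (volume.restrict (Ioi x)) := by
      have := (hf.norm.sub (integrableOn_exp_mul hμ hf.norm)).div_const μ
      refine this.congr (Eventually.of_forall fun s => ?_)
      simp only [Pi.sub_apply, Real.norm_eq_abs]
      ring
    refine h2.congr ?_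
    filter_upwards [ae_restrict_mem measurableSet_Ioi] with s hs
    rw [← integral_indicator_Iio hμ hs (fun s => |f s|)]
    refine integral_congr_ae (Eventually.of_forall fun t => ?_)
    simp only [Function.uncurry, indicator_apply, mem_Ioi]
    split_ifs <;> simp

lemma setIntegral_kernel {x t : ℝ} (hxt : x < t) (f : ℝ → ℝ) :
    ∫ s in Ioi x, (Ioi t).indicator (fun s => Real.exp (-μ * (s - t)) * f s) s
      = discount μ f t := by
  rw [setIntegral_indicator measurableSet_Ioi, Ioi_inter_Ioi, sup_of_le_right hxt.le, discount]

lemma integrableOn_discount (hμ : 0 < μ) (hfm : Measurable f) {x : ℝ}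
    (hf : IntegrableOn f (Ioi x)) : IntegrableOn (discount μ f) (Ioi x) := by
  refine (integrable_discount_kernel hμ hfm hf).integral_prod_left.congr ?_
  filter_upwards [ae_restrict_mem measurableSet_Ioi] with t ht
  exact setIntegral_kernel ht f

lemma setIntegral_discount (hμ : 0 < μ) (hfm : Measurable f) {x : ℝ}
    (hf : IntegrableOn f (Ioi x)) :
    μ * ∫ t in Ioi x, discount μ f t = (∫ t in Ioi x, f t) - discount μ f x := by
  have h1 : ∫ t in Ioi x, discount μ f t
      = ∫ t in Ioi x, ∫ s in Ioi x,
        (Ioi t).indicator (fun s => Real.exp (-μ * (s - t)) * f s) s :=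
    setIntegral_congr_fun measurableSet_Ioi fun t ht => (setIntegral_kernel ht f).symm
  rw [h1, integral_integral_swap (integrable_discount_kernel hμ hfm hf),
    setIntegral_congr_fun measurableSet_Ioi fun s hs => integral_indicator_Iio hμ hs f,
    discount, ← integral_sub hf (integrableOn_exp_mul hμ hf), ← integral_const_mul]
  congr 1 with s
  field_simp

lemma integrableOn_expCorrection (hμ : 0 < μ) (hfm : Measurable f) {x : ℝ}
    (hf : IntegrableOn f (Ioi x)) : IntegrableOn (expCorrection μ f) (Ioi x) :=
  hf.sub ((integrableOn_discount hμ hfm hf).const_mul μ)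

/-- Formally, `discount μ f` has derivative `μ * discount μ f - f`. Fubini gives the integrated form
without any regularity of `f`, so `expCorrection μ f` is the density whose tail is `discount μ f`.
-/
lemma setIntegral_expCorrection (hμ : 0 < μ) (hfm : Measurable f) {x : ℝ}
    (hf : IntegrableOn f (Ioi x)) :
    ∫ t in Ioi x, expCorrection μ f t = discount μ f x := by
  have := setIntegral_discount hμ hfm hf
  calc ∫ t in Ioi x, expCorrection μ f t = ∫ t in Ioi x, (f t - μ * discount μ f t) := rfl
    _ = _ := by
      rw [integral_sub hf ((integrableOn_discount hμ hfm hf).const_mul μ), integral_const_mul]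
      linarith

lemma laplace_eq_discount : laplace f μ = discount μ f 0 := by
  simp [laplace, discount]

lemma exp_mul_setIntegral_eq_discount (x : ℝ) :
    Real.exp (μ * x) * ∫ s in Ioi x, Real.exp (-μ * s) * f s = discount μ f x := by
  rw [← integral_const_mul, discount]
  congr 1 with s
  rw [← mul_assoc, ← Real.exp_add]
  ring_nf

lemma setIntegral_shift (u : ℝ → ℝ) (x : ℝ) :
    ∫ a in Ioi (0 : ℝ), u (x + a) = ∫ s in Ioi x, u s := by
  have := (measurePreserving_add_left volume x).setIntegral_preimage_emb
    (measurableEmbedding_addLeft x) u (Ioi x)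
  rwa [preimage_const_add_Ioi, sub_self] at this

lemma integrableOn_shift {u : ℝ → ℝ} {x : ℝ} (hu : IntegrableOn u (Ioi x)) :
    IntegrableOn (fun a => u (x + a)) (Ioi 0) := by
  have := (measurePreserving_add_left volume x).integrableOn_comp_preimage
    (measurableEmbedding_addLeft x) (f := u) (s := Ioi x)
  rw [preimage_const_add_Ioi, sub_self] at this
  exact this.2 hu

lemma expMeasure_eq (μ : ℝ) : expMeasure μ
    = (volume.restrict (Ioi 0)).withDensity fun a => ENNReal.ofReal (μ * Real.exp (-μ * a)) := by
  have h1 : expMeasure μ = volume.withDensity (exponentialPDF μ) := rfl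
  rw [h1, ← withDensity_indicator measurableSet_Ioi]
  refine withDensity_congr_ae ?_
  -- The library density is supported on the closed half-line; the point `0` is null.
  filter_upwards [Measure.ae_ne volume (0 : ℝ)] with a ha
  rw [exponentialPDF_eq]
  rcases lt_or_gt_of_ne ha with h | h
  · rw [if_neg (not_le.2 h), indicator_of_notMem (by simpa using h.le), ENNReal.ofReal_zero]
  · rw [if_pos h.le, indicator_of_mem (mem_Ioi.2 h), neg_mul]

lemma integral_expMeasure (hμ : 0 < μ) (u : ℝ → ℝ) :
    ∫ a, u a ∂expMeasure μ = ∫ a in Ioi 0, μ * Real.exp (-μ * a) * u a := by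
  rw [expMeasure_eq, integral_withDensity_eq_integral_toReal_smul (by fun_prop) (by simp)]
  congr 1 with a
  rw [ENNReal.toReal_ofReal (by positivity), smul_eq_mul]

lemma integrable_shift_expMeasure (hμ : 0 < μ) {x : ℝ} (hf : IntegrableOn f (Ioi x)) :
    Integrable (fun a => f (x + a)) (expMeasure μ) := by
  rw [expMeasure_eq, integrable_withDensity_iff_integrable_smul' (by fun_prop) (by simp)]
  refine ((integrableOn_shift (integrableOn_exp_mul hμ hf)).const_mul μ).congr
    (Eventually.of_forall fun a => ?_)
  beta_reduce
  rw [ENNReal.toReal_ofReal (by positivity), smul_eq_mul, add_sub_cancel_left, mul_assoc]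

lemma integral_shift_expMeasure (hμ : 0 < μ) (x : ℝ) :
    ∫ a, f (x + a) ∂expMeasure μ = μ * discount μ f x := by
  rw [integral_expMeasure hμ, discount,
    ← setIntegral_shift (fun s => Real.exp (-μ * (s - x)) * f s), ← integral_const_mul]
  congr 1 with a
  rw [add_sub_cancel_left, mul_assoc]

end

/-! ### Tails of the one-step law -/

lemma measureReal_prod_apply {α β : Type*} [MeasurableSpace α] [MeasurableSpace β]
    (κ : Measure α) (lam : Measure β) [IsFiniteMeasure κ] [IsFiniteMeasure lam]
    {s : Set (α × β)} (hs : MeasurableSet s) :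
    (κ.prod lam).real s = ∫ x, lam.real (Prod.mk x ⁻¹' s) ∂κ := by
  rw [measureReal_def, Measure.prod_apply hs]
  exact (integral_toReal (measurable_measure_prodMk_left hs).aemeasurable
    (Eventually.of_forall fun _ => measure_lt_top _ _)).symm

lemma measureReal_prod_apply_symm {α β : Type*} [MeasurableSpace α] [MeasurableSpace β]
    (κ : Measure α) (lam : Measure β) [IsFiniteMeasure κ] [IsFiniteMeasure lam]
    {s : Set (α × β)} (hs : MeasurableSet s) :
    (κ.prod lam).real s = ∫ y, κ.real ((fun x => (x, y)) ⁻¹' s) ∂lam := by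
  rw [measureReal_def, Measure.prod_apply_symm hs]
  exact (integral_toReal (measurable_measure_prodMk_right hs).aemeasurable
    (Eventually.of_forall fun _ => measure_lt_top _ _)).symm

lemma tail_eq (νB : Measure ℝ) [IsProbabilityMeasure νB] (t : ℝ) :
    tail νB t = νB.real (Ioi t) := by
  rw [tail, cdf_eq_real, ← compl_Iic, probReal_compl_eq_one_sub measurableSet_Iic]

lemma measurable_tail (νB : Measure ℝ) : Measurable (tail νB) :=
  measurable_const.sub (monotone_cdf νB).measurable

/-- For `x ≥ 0` the maximum with `0` plays no role: exceeding `x` means `B > x + A + W`, and one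
conditions on `W` and `A`. -/
lemma lindley_real_Ioi (νA νB m : Measure ℝ) [IsProbabilityMeasure νA] [IsProbabilityMeasure νB]
    [IsFiniteMeasure m] {x : ℝ} (hx : 0 ≤ x) :
    (lindley (νB.prod νA) m).real (Ioi x) = ∫ w, ∫ a, tail νB (x + a + w) ∂νA ∂m := by
  have h1 : (fun p : ℝ × ℝ × ℝ => max 0 (p.2.1 - p.2.2 - p.1)) ⁻¹' Ioi x
      = {p | x + p.2.2 + p.1 < p.2.1} := by
    ext p
    simp only [mem_preimage, mem_Ioi, lt_max_iff, not_lt.2 hx, false_or, mem_ofPred_eq]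
    constructor <;> intro h <;> linarith
  have h2 : MeasurableSet {p : ℝ × ℝ × ℝ | x + p.2.2 + p.1 < p.2.1} :=
    measurableSet_lt (by fun_prop) (by fun_prop)
  rw [lindley, map_measureReal_apply measurable_lindleyMap measurableSet_Ioi, h1,
    measureReal_prod_apply _ _ h2]
  congr 1 with w
  rw [measureReal_prod_apply_symm _ _ (measurable_prodMk_left h2)]
  congr 1 with a
  rw [tail_eq]
  rfl

/-- A finite measure on the half-line is determined by its atom at `0` and its tails. -/
lemma ext_of_singleton_Ioi {a b : Measure ℝ} [IsFiniteMeasure a] [IsFiniteMeasure b]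
    (ha : a (Iio 0) = 0) (hb : b (Iio 0) = 0) (h0 : a.real {0} = b.real {0})
    (h : ∀ x, 0 ≤ x → a.real (Ioi x) = b.real (Ioi x)) : a = b := by
  have key : ∀ (m : Measure ℝ) [IsFiniteMeasure m], m (Iio 0) = 0 → ∀ x, 0 ≤ x →
      m.real (Iic x) = m.real {0} + m.real (Ioi 0) - m.real (Ioi x) := by
    intro m _ hm x hx
    have h1 : m.real (Iic x) + m.real (Ioi x) = m.real univ := by
      rw [← compl_Iic, measureReal_add_measureReal_compl measurableSet_Iic]
    have h2 : m.real (Iic 0) + m.real (Ioi 0) = m.real univ := by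
      rw [← compl_Iic, measureReal_add_measureReal_compl measurableSet_Iic]
    have h3 : m.real (Iic 0) = m.real {0} := by
      rw [measureReal_def, measureReal_def, ← Iio_union_right, measure_union (by simp)
        (measurableSet_singleton _), hm, zero_add]
    linarith
  refine Measure.ext_of_Iic _ _ fun x => ?_
  rcases lt_or_ge x 0 with hx | hx
  · rw [measure_mono_null (Iic_subset_Iio.2 hx) ha, measure_mono_null (Iic_subset_Iio.2 hx) hb]
  · rw [← ENNReal.toReal_eq_toReal_iff' (measure_ne_top _ _) (measure_ne_top _ _),
      ← measureReal_def, ← measureReal_def, key a ha x hx, key b hb x hx, h0, h x hx,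
      h 0 le_rfl]

lemma measureReal_univ_eq {m : Measure ℝ} [IsFiniteMeasure m] (hm : m (Iio 0) = 0) :
    m.real univ = m.real {0} + m.real (Ioi 0) := by
  have h1 : m.real (Iio 0) = 0 := by rw [measureReal_def, hm, ENNReal.toReal_zero]
  have h2 : m.real (Iic 0) = m.real (Iio 0) + m.real {0} := by
    rw [← Iio_union_right, measureReal_union (by simp) (measurableSet_singleton _)]
  rw [← measureReal_add_measureReal_compl (measurableSet_Iic (a := (0 : ℝ))), h2, h1, zero_add,
    compl_Iic]

/-! ### Signed measures with an atom and a density -/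

/-- The positive part of the signed measure with atom `π₀` at `0` and density `p` on the open
half-line. -/
def posPart (π₀ : ℝ) (p : ℝ → ℝ) : Measure ℝ :=
  ENNReal.ofReal π₀ • Measure.dirac 0
    + (volume.restrict (Ioi 0)).withDensity fun x => ENNReal.ofReal (p x)

section

variable {π₀ : ℝ} {p : ℝ → ℝ}

lemma isFiniteMeasure_posPart (hp : IntegrableOn p (Ioi 0)) :
    IsFiniteMeasure (posPart π₀ p) := by
  have h1 : IsFiniteMeasure ((volume.restrict (Ioi 0)).withDensity
      fun x => ENNReal.ofReal (p x)) :=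
    isFiniteMeasure_withDensity_ofReal hp.2
  have h2 : IsFiniteMeasure (ENNReal.ofReal π₀ • (Measure.dirac 0 : Measure ℝ)) :=
    Measure.smul_finite _ ENNReal.ofReal_ne_top
  unfold posPart
  infer_instance

lemma posPart_restrict : (posPart π₀ p).restrict (Ioi 0)
    = (volume.restrict (Ioi 0)).withDensity fun x => ENNReal.ofReal (p x) := by
  rw [posPart, Measure.restrict_add, Measure.restrict_smul, restrict_dirac' measurableSet_Ioi,
    restrict_withDensity measurableSet_Ioi, Measure.restrict_restrict measurableSet_Ioi,
    inter_self]
  simp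

lemma posPart_apply_of_disjoint {s : Set ℝ} (hs : MeasurableSet s) (h : Disjoint s (Ioi 0)) :
    posPart π₀ p s = ENNReal.ofReal π₀ * Measure.dirac (0 : ℝ) s := by
  have : ((volume.restrict (Ioi 0)).withDensity fun x => ENNReal.ofReal (p x)) s = 0 := by
    refine withDensity_absolutelyContinuous _ _ ?_
    rw [Measure.restrict_apply hs, h.inter_eq, measure_empty]
  rw [posPart, Measure.add_apply, this, add_zero, Measure.smul_apply, smul_eq_mul]

lemma posPart_Iio : posPart π₀ p (Iio 0) = 0 := by
  rw [posPart_apply_of_disjoint measurableSet_Iio (by simp)]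
  simp

lemma posPart_real_singleton : (posPart π₀ p).real {0} = max π₀ 0 := by
  rw [measureReal_def, posPart_apply_of_disjoint (measurableSet_singleton 0) (by simp)]
  simp [ENNReal.toReal_ofReal']

lemma setIntegral_posPart (hp : IntegrableOn p (Ioi 0)) (u : ℝ → ℝ) :
    ∫ x in Ioi 0, u x ∂posPart π₀ p = ∫ x in Ioi 0, max (p x) 0 * u x := by
  rw [posPart_restrict, integral_withDensity_eq_integral_toReal_smul₀
    hp.aestronglyMeasurable.aemeasurable.ennreal_ofReal (by simp)]
  simp_rw [ENNReal.toReal_ofReal', smul_eq_mul]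

/-- Negating both the atom and the density turns `posPart` into the negative part, so the difference
integrates against `p` itself. -/
lemma setIntegral_posPart_sub (hp : IntegrableOn p (Ioi 0)) {u : ℝ → ℝ} (hu : Measurable u)
    {C : ℝ} (hC : ∀ y, 0 < y → |u y| ≤ C) :
    ∫ x in Ioi 0, u x ∂posPart π₀ p - ∫ x in Ioi 0, u x ∂posPart (-π₀) (-p)
      = ∫ x in Ioi 0, u x * p x := by
  have h1 : ∀ᵐ x ∂volume.restrict (Ioi (0 : ℝ)), ‖u x‖ ≤ C := by
    filter_upwards [ae_restrict_mem measurableSet_Ioi] with x hx using hC x hx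
  rw [setIntegral_posPart hp, setIntegral_posPart hp.neg, ← integral_sub
    (hp.pos_part.mul_bdd hu.aestronglyMeasurable h1)
    (hp.neg.pos_part.mul_bdd hu.aestronglyMeasurable h1)]
  congr 1 with x
  rw [← sub_mul, mul_comm, Pi.neg_apply]
  congr 1
  rcases le_total 0 (p x) with h | h
  · rw [max_eq_left h, max_eq_right (by linarith)]; ring
  · rw [max_eq_right h, max_eq_left (by linarith)]; ring

lemma posPart_sub_real_Ioi (hp : IntegrableOn p (Ioi 0)) {x : ℝ} (hx : 0 ≤ x) :
    (posPart π₀ p).real (Ioi x) - (posPart (-π₀) (-p)).real (Ioi x) = ∫ t in Ioi x, p t := by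
  have h1 : ∀ m : Measure ℝ, ∫ t in Ioi 0, (Ioi x).indicator (fun _ => (1 : ℝ)) t ∂m
      = m.real (Ioi x) := by
    intro m
    rw [setIntegral_indicator measurableSet_Ioi, Ioi_inter_Ioi, sup_of_le_right hx]
    simp
  have h2 := setIntegral_posPart_sub (π₀ := π₀) hp (u := (Ioi x).indicator fun _ => (1 : ℝ))
    (measurable_const.indicator measurableSet_Ioi) (C := 1) (by
      intro y _
      by_cases h : y ∈ Ioi x <;> simp [h])
  rw [h1, h1] at h2
  rw [h2]
  have h3 : ∀ t, (Ioi x).indicator (fun _ => (1 : ℝ)) t * p t = (Ioi x).indicator p t := by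
    intro t
    by_cases h : t ∈ Ioi x <;> simp [h]
  simp_rw [h3]
  rw [setIntegral_indicator measurableSet_Ioi, Ioi_inter_Ioi, sup_of_le_right hx]

lemma posPart_sub_real_singleton :
    (posPart π₀ p).real {0} - (posPart (-π₀) (-p)).real {0} = π₀ := by
  rw [posPart_real_singleton, posPart_real_singleton]
  rcases le_total 0 π₀ with h | h
  · rw [max_eq_left h, max_eq_right (by linarith)]; ring
  · rw [max_eq_right h, max_eq_left (by linarith)]; ring

end

/-- Some level `N` has `B ≤ N` with positive probability, and independently `A > N` with probability
`exp (-μ N) > 0`. -/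
lemma prod_expMeasure_compl_ne_zero {μ : ℝ} (hμ : 0 < μ) (νB : Measure ℝ)
    [IsProbabilityMeasure νB] :
    νB.prod (expMeasure μ) {p | p.2 < p.1}ᶜ ≠ 0 := by
  have := isProbabilityMeasure_expMeasure hμ
  obtain ⟨N, hN⟩ : ∃ N : ℕ, 0 < νB (Iic (N : ℝ)) := by
    refine exists_measure_pos_of_not_measure_iUnion_null ?_
    have : ⋃ N : ℕ, Iic (N : ℝ) = univ :=
      eq_univ_of_forall fun x => mem_iUnion.2 (exists_nat_ge x)
    rw [this]
    simp
  have h1 : 0 < expMeasure μ (Ioi (N : ℝ)) := by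
    have h2 : (expMeasure μ).real (Ioi (N : ℝ)) = Real.exp (-(μ * N)) := by
      rw [← compl_Iic, probReal_compl_eq_one_sub measurableSet_Iic, ← cdf_eq_real,
        cdf_expMeasure_eq hμ, if_pos N.cast_nonneg]
      ring
    refine pos_iff_ne_zero.2 fun h => ?_
    rw [measureReal_def, h, ENNReal.toReal_zero] at h2
    exact (Real.exp_pos _).ne h2
  have h2 : Iic (N : ℝ) ×ˢ Ioi (N : ℝ) ⊆ {p : ℝ × ℝ | p.2 < p.1}ᶜ := by
    rintro ⟨b, a⟩ ⟨hb, ha⟩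
    simpa using (le_trans hb (le_of_lt ha) : b ≤ a)
  refine (lt_of_lt_of_le ?_ (measure_mono h2)).ne'
  rw [Measure.prod_prod]
  exact ENNReal.mul_pos hN.ne' h1.ne'

/-! ### The linear system and the stationary law -/

/-- The density on the open half-line attached to the unknowns of the linear system. -/
def density (μ : ℝ) (νB : Measure ℝ) {n : ℕ} (g : Fin n → ℝ → ℝ) (π₀ : ℝ) (c : Fin n → ℝ)
    (x : ℝ) : ℝ :=
  μ * π₀ * expCorrection μ (tail νB) x + μ * ∑ i, c i * expCorrection μ (g i) x

section

variable {μ : ℝ} {νB : Measure ℝ} {n : ℕ} {g h : Fin n → ℝ → ℝ}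

/-- Taking `y = 0` in the decomposition writes the tail as a finite combination of the `g i`. -/
lemma integrableOn_tail (h_decomp : TailDecomposition νB g h)
    (hg_int : ∀ i, IntegrableOn (g i) (Ioi 0)) : IntegrableOn (tail νB) (Ioi 0) := by
  have h1 : IntegrableOn (fun x => ∑ i, g i x * h i 0) (Ioi 0) :=
    integrable_finsetSum _ fun i _ => (hg_int i).mul_const _
  refine h1.congr_fun (fun x hx => ?_) measurableSet_Ioi
  beta_reduce
  rw [← h_decomp.tail_add x 0 (le_of_lt hx) le_rfl, add_zero]

lemma integrableOn_mul_expCorrection (hμ : 0 < μ) {f u : ℝ → ℝ} (hf : Measurable f)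
    (hf_int : IntegrableOn f (Ioi 0)) (hu : Measurable u) (hb : ∃ C, ∀ y, 0 < y → |u y| ≤ C) :
    IntegrableOn (fun x => u x * expCorrection μ f x) (Ioi 0) := by
  obtain ⟨C, hC⟩ := hb
  refine (integrableOn_expCorrection hμ hf hf_int).bdd_mul (c := C) hu.aestronglyMeasurable ?_
  filter_upwards [ae_restrict_mem measurableSet_Ioi] with x hx using hC x hx

/-- Integrating against the density is linear in the unknowns. -/
lemma setIntegral_mul_density {π₀ : ℝ} {c : Fin n → ℝ} {s : Set ℝ} {u : ℝ → ℝ}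
    (h1 : IntegrableOn (fun x => u x * expCorrection μ (tail νB) x) s)
    (h2 : ∀ i, IntegrableOn (fun x => u x * expCorrection μ (g i) x) s) :
    ∫ x in s, u x * density μ νB g π₀ c x
      = μ * π₀ * (∫ x in s, u x * expCorrection μ (tail νB) x)
        + μ * ∑ i, c i * ∫ x in s, u x * expCorrection μ (g i) x := by
  have h3 : ∀ x, u x * density μ νB g π₀ c x
      = μ * π₀ * (u x * expCorrection μ (tail νB) x)
        + μ * ∑ i, c i * (u x * expCorrection μ (g i) x) := by
    intro x
    rw [density, mul_add, mul_left_comm, mul_left_comm (u x), Finset.mul_sum]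
    simp_rw [mul_left_comm (u x)]
  simp_rw [h3]
  rw [integral_add (h1.const_mul _)
    ((integrable_finsetSum _ fun i _ => (h2 i).const_mul _).const_mul _), integral_const_mul,
    integral_const_mul, integral_finsetSum _ fun i _ => (h2 i).const_mul _]
  simp_rw [integral_const_mul]

lemma integrableOn_density (hμ : 0 < μ) (h_decomp : TailDecomposition νB g h)
    (hg_int : ∀ i, IntegrableOn (g i) (Ioi 0)) (π₀ : ℝ) (c : Fin n → ℝ) :
    IntegrableOn (density μ νB g π₀ c) (Ioi 0) :=
  ((integrableOn_expCorrection hμ (measurable_tail νB)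
    (integrableOn_tail h_decomp hg_int)).const_mul _).add
    ((integrable_finsetSum _ fun i _ => (integrableOn_expCorrection hμ (h_decomp.measurable_g i)
      (hg_int i)).const_mul _).const_mul _)

lemma setIntegral_density (hμ : 0 < μ) (h_decomp : TailDecomposition νB g h)
    (hg_int : ∀ i, IntegrableOn (g i) (Ioi 0)) (π₀ : ℝ) (c : Fin n → ℝ) {x : ℝ} (hx : 0 ≤ x) :
    ∫ t in Ioi x, density μ νB g π₀ c t
      = μ * π₀ * discount μ (tail νB) x + μ * ∑ i, c i * discount μ (g i) x := by
  have ht := (integrableOn_tail h_decomp hg_int).mono_set (Ioi_subset_Ioi hx)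
  have hg := fun i => (hg_int i).mono_set (Ioi_subset_Ioi hx)
  have := setIntegral_mul_density (μ := μ) (νB := νB) (g := g) (π₀ := π₀) (c := c) (s := Ioi x)
    (u := fun _ => 1)
    (by simpa using integrableOn_expCorrection hμ (measurable_tail νB) ht)
    (fun i => by simpa using integrableOn_expCorrection hμ (h_decomp.measurable_g i) (hg i))
  simp only [one_mul] at this
  rw [this, setIntegral_expCorrection hμ (measurable_tail νB) ht]
  simp_rw [fun i => setIntegral_expCorrection hμ (h_decomp.measurable_g i) (hg i)]

lemma waitingCDF_eq (hμ : 0 < μ) (h_decomp : TailDecomposition νB g h)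
    (hg_int : ∀ i, IntegrableOn (g i) (Ioi 0)) (π₀ : ℝ) (c : Fin n → ℝ) {x : ℝ} (hx : 0 ≤ x) :
    waitingCDF μ νB g π₀ c x = 1 - ∫ t in Ioi x, density μ νB g π₀ c t := by
  have h1 := integrableOn_exp_mul hμ
    ((integrableOn_tail h_decomp hg_int).mono_set (Ioi_subset_Ioi hx))
  have h2 := fun i => integrableOn_exp_mul hμ ((hg_int i).mono_set (Ioi_subset_Ioi hx))
  have h3 : ∀ s, Real.exp (-μ * (s - x)) * (μ * π₀ * tail νB s + μ * ∑ i, c i * g i s)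
      = μ * π₀ * (Real.exp (-μ * (s - x)) * tail νB s)
        + μ * ∑ i, c i * (Real.exp (-μ * (s - x)) * g i s) := by
    intro s
    rw [mul_add, mul_left_comm, mul_left_comm (Real.exp _) μ, Finset.mul_sum]
    simp_rw [mul_left_comm (Real.exp _)]
  rw [waitingCDF, exp_mul_setIntegral_eq_discount, setIntegral_density hμ h_decomp hg_int π₀ c hx,
    discount]
  simp_rw [h3]
  rw [integral_add (h1.const_mul _)
    ((integrable_finsetSum _ fun i _ => (h2 i).const_mul _).const_mul _), integral_const_mul,
    integral_const_mul, integral_finsetSum _ fun i _ => (h2 i).const_mul _]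
  simp_rw [integral_const_mul]
  rfl

/-- The linear system says that the signed measure with atom `π₀` and density `density` has
total mass one and moments `c`. -/
lemma solvesSystem_iff (hμ : 0 < μ) (h_decomp : TailDecomposition νB g h)
    (hh_bdd : ∀ i, ∃ C : ℝ, ∀ y : ℝ, 0 < y → |h i y| ≤ C)
    (hg_int : ∀ i, IntegrableOn (g i) (Ioi 0)) (π₀ : ℝ) (c : Fin n → ℝ) :
    SolvesSystem μ νB g h π₀ c ↔
      π₀ + ∫ x in Ioi 0, density μ νB g π₀ c x = 1
      ∧ ∀ i, c i = ∫ x in Ioi 0, h i x * density μ νB g π₀ c x := by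
  have h1 : π₀ + ∫ x in Ioi 0, density μ νB g π₀ c x
      = π₀ + μ * π₀ * laplace (tail νB) μ + μ * ∑ i, c i * laplace (g i) μ := by
    rw [setIntegral_density hμ h_decomp hg_int π₀ c le_rfl]
    simp only [laplace_eq_discount, add_assoc]
  have h2 : ∀ i, ∫ x in Ioi 0, h i x * density μ νB g π₀ c x
      = μ * π₀ * (∫ x in Ioi (0 : ℝ), h i x * expCorrection μ (tail νB) x)
      + μ * ∑ j, c j * ∫ x in Ioi (0 : ℝ), h i x * expCorrection μ (g j) x := fun i =>
    setIntegral_mul_density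
      (integrableOn_mul_expCorrection hμ (measurable_tail νB) (integrableOn_tail h_decomp hg_int)
        (h_decomp.measurable_h i) (hh_bdd i))
      (fun j => integrableOn_mul_expCorrection hμ (h_decomp.measurable_g j) (hg_int j)
        (h_decomp.measurable_h i) (hh_bdd i))
  rw [h1]
  simp_rw [h2]
  exact ⟨fun hS => ⟨hS.normalization, hS.coefficients⟩, fun hS => ⟨hS.1, hS.2⟩⟩

/-- The tail of the law after one step depends on the initial law only through its atom at `0`
and the moments of the `h i`. -/
lemma lindley_real_Ioi_eq (hμ : 0 < μ) [IsProbabilityMeasure νB]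
    (h_decomp : TailDecomposition νB g h)
    (hh_bdd : ∀ i, ∃ C : ℝ, ∀ y : ℝ, 0 < y → |h i y| ≤ C)
    (hg_int : ∀ i, IntegrableOn (g i) (Ioi 0)) (m : Measure ℝ) [IsFiniteMeasure m]
    (hm : m (Iio 0) = 0) {x : ℝ} (hx : 0 ≤ x) :
    (lindley (νB.prod (expMeasure μ)) m).real (Ioi x)
      = μ * m.real {0} * discount μ (tail νB) x
        + μ * ∑ i, (∫ w in Ioi 0, h i w ∂m) * discount μ (g i) x := by
  have := isProbabilityMeasure_expMeasure hμ
  have hA : ∀ᵐ a ∂expMeasure μ, 0 < a := by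
    rw [expMeasure_eq]
    exact withDensity_absolutelyContinuous _ _ (ae_restrict_mem measurableSet_Ioi)
  have hg := fun i => (hg_int i).mono_set (Ioi_subset_Ioi hx)
  have h1 : ∀ w ∈ Ioi (0 : ℝ), ∑ i, h i w * (μ * discount μ (g i) x)
      = ∫ a, tail νB (x + a + w) ∂expMeasure μ := by
    intro w hw
    rw [integral_congr_ae (g := fun a => ∑ i, h i w * g i (x + a)), integral_finsetSum]
    · simp_rw [integral_const_mul, integral_shift_expMeasure hμ x]
    · exact fun i _ => (integrable_shift_expMeasure hμ (hg i)).const_mul _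
    · filter_upwards [hA] with a ha
      rw [h_decomp.tail_add _ _ (by linarith) (le_of_lt hw)]
      exact Finset.sum_congr rfl fun i _ => mul_comm _ _
  have h2 : ∀ i, IntegrableOn (h i) (Ioi 0) m := by
    intro i
    obtain ⟨C, hC⟩ := hh_bdd i
    refine Integrable.of_bound (h_decomp.measurable_h i).aestronglyMeasurable C ?_
    filter_upwards [ae_restrict_mem measurableSet_Ioi] with y hy using hC y hy
  have h3 : IntegrableOn (fun w => ∑ i, h i w * (μ * discount μ (g i) x)) (Ioi 0) m :=
    integrable_finsetSum _ fun i _ => (h2 i).mul_const _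
  -- The atom is split off because the `h i` are bounded only on the open half-line; at `w = 0` the
  -- undecomposed tail is used.
  have h4 : m.restrict ({0} ∪ Ioi 0) = m := by
    refine Measure.restrict_eq_self_of_ae_mem ?_
    refine measure_mono_null (fun w hw => ?_) hm
    rw [mem_compl_iff, mem_ofPred_eq, mem_union, not_or, mem_singleton_iff, mem_Ioi, not_lt] at hw
    exact lt_of_le_of_ne hw.2 hw.1
  rw [lindley_real_Ioi _ _ _ hx]
  conv_lhs => rw [← h4]
  rw [setIntegral_union (by simp) measurableSet_Ioi integrableOn_singleton
    (h3.congr_fun h1 measurableSet_Ioi), integral_singleton,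
    ← setIntegral_congr_fun measurableSet_Ioi h1,
    integral_finsetSum _ fun i _ => (h2 i).mul_const _]
  simp_rw [add_zero, integral_shift_expMeasure hμ x, integral_mul_const, smul_eq_mul]
  rw [Finset.mul_sum]
  congr 1
  · ring
  · exact Finset.sum_congr rfl fun i _ => by ring

/-- A stationary law solves the linear system. -/
lemma exists_solvesSystem (hμ : 0 < μ) [IsProbabilityMeasure νB]
    (h_decomp : TailDecomposition νB g h)
    (hh_bdd : ∀ i, ∃ C : ℝ, ∀ y : ℝ, 0 < y → |h i y| ≤ C)
    (hg_int : ∀ i, IntegrableOn (g i) (Ioi 0)) {ν : Measure ℝ} [IsProbabilityMeasure ν]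
    (hν : ν (Iio 0) = 0) (hfix : lindley (νB.prod (expMeasure μ)) ν = ν) :
    SolvesSystem μ νB g h (ν.real {0}) fun i => ∫ w in Ioi 0, h i w ∂ν := by
  set π₀ := ν.real {0} with hπ
  set c : Fin n → ℝ := fun i => ∫ w in Ioi 0, h i w ∂ν with hc
  set p := density μ νB g π₀ c with hp
  have hpi : IntegrableOn p (Ioi 0) := integrableOn_density hμ h_decomp hg_int π₀ c
  have h1 : ∀ x, 0 ≤ x → ν.real (Ioi x) = ∫ t in Ioi x, p t := by
    intro x hx
    rw [setIntegral_density hμ h_decomp hg_int π₀ c hx,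
      ← lindley_real_Ioi_eq hμ h_decomp hh_bdd hg_int ν hν hx, hfix]
  have : IsFiniteMeasure (posPart π₀ p) := isFiniteMeasure_posPart hpi
  have : IsFiniteMeasure (posPart (-π₀) (-p)) := isFiniteMeasure_posPart hpi.neg
  -- Stationarity makes the tails of `ν` integrals of `p`, so `ν` is the signed measure with atom
  -- `π₀` and density `p`; its moments can then be computed from `p`.
  have h2 : ν + posPart (-π₀) (-p) = posPart π₀ p := by
    refine ext_of_singleton_Ioi (by simp [hν, posPart_Iio]) posPart_Iio ?_ fun x hx => ?_
    · rw [measureReal_add_apply]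
      linarith [posPart_sub_real_singleton (π₀ := π₀) (p := p)]
    · rw [measureReal_add_apply, h1 x hx]
      linarith [posPart_sub_real_Ioi (π₀ := π₀) hpi hx]
  rw [solvesSystem_iff hμ h_decomp hh_bdd hg_int]
  constructor
  · rw [← h1 0 le_rfl, hπ, ← measureReal_univ_eq hν, probReal_univ]
  · intro i
    obtain ⟨C, hC⟩ := hh_bdd i
    rw [← setIntegral_posPart_sub (π₀ := π₀) hpi (h_decomp.measurable_h i) hC, ← h2,
      Measure.restrict_add, integral_add_measure, add_sub_cancel_right]
    all_goals
      refine Integrable.of_bound (h_decomp.measurable_h i).aestronglyMeasurable C ?_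
      filter_upwards [ae_restrict_mem measurableSet_Ioi] with y hy using hC y hy

/-- Every solution of the linear system describes the stationary law. -/
lemma eq_of_solvesSystem (hμ : 0 < μ) [IsProbabilityMeasure νB]
    (h_decomp : TailDecomposition νB g h)
    (hh_bdd : ∀ i, ∃ C : ℝ, ∀ y : ℝ, 0 < y → |h i y| ≤ C)
    (hg_int : ∀ i, IntegrableOn (g i) (Ioi 0)) {ν : Measure ℝ} [IsProbabilityMeasure ν]
    (hν : ν (Iio 0) = 0) (hfix : lindley (νB.prod (expMeasure μ)) ν = ν) {π₀ : ℝ}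
    {c : Fin n → ℝ} (hS : SolvesSystem μ νB g h π₀ c) :
    ν.real {0} = π₀ ∧ ∀ x, 0 ≤ x → cdf ν x = waitingCDF μ νB g π₀ c x := by
  have := isProbabilityMeasure_expMeasure hμ
  obtain ⟨hmass, hmom⟩ := (solvesSystem_iff hμ h_decomp hh_bdd hg_int π₀ c).1 hS
  set p := density μ νB g π₀ c with hp
  have hpi : IntegrableOn p (Ioi 0) := integrableOn_density hμ h_decomp hg_int π₀ c
  set a := posPart π₀ p with ha
  set b := posPart (-π₀) (-p) with hb
  have : IsFiniteMeasure a := isFiniteMeasure_posPart hpi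
  have : IsFiniteMeasure b := isFiniteMeasure_posPart hpi.neg
  have ha0 : a (Iio 0) = 0 := posPart_Iio
  have hb0 : b (Iio 0) = 0 := posPart_Iio
  have h0 : a.real {0} - b.real {0} = π₀ := posPart_sub_real_singleton
  have hIoi : ∀ x, 0 ≤ x → a.real (Ioi x) - b.real (Ioi x) = ∫ t in Ioi x, p t :=
    fun x hx => posPart_sub_real_Ioi hpi hx
  set T := lindley (νB.prod (expMeasure μ)) with hT
  -- The signed measure `a - b` has atom `π₀` and moments `c`, so its image under `T` has the tails
  -- prescribed by `p`.
  have hTIoi : ∀ x, 0 ≤ x → (T a).real (Ioi x) - (T b).real (Ioi x) = ∫ t in Ioi x, p t := by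
    intro x hx
    have h1 : ∀ i, c i = ∫ w in Ioi 0, h i w ∂a - ∫ w in Ioi 0, h i w ∂b := by
      intro i
      obtain ⟨C, hC⟩ := hh_bdd i
      rw [hmom i, ha, hb, setIntegral_posPart_sub hpi (h_decomp.measurable_h i) hC]
    rw [hT, lindley_real_Ioi_eq hμ h_decomp hh_bdd hg_int a ha0 hx,
      lindley_real_Ioi_eq hμ h_decomp hh_bdd hg_int b hb0 hx,
      setIntegral_density hμ h_decomp hg_int π₀ c hx]
    simp_rw [h1, sub_mul]
    rw [Finset.sum_sub_distrib, ← h0]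
    ring
  have huniv : ∀ (m : Measure ℝ) [IsFiniteMeasure m], (T m).real univ = m.real univ := by
    intro m _
    rw [measureReal_def, measureReal_def, hT, lindley_univ, measure_univ, one_mul]
  have hTa0 : T a (Iio 0) = 0 := lindley_Iio a
  have hTb0 : T b (Iio 0) = 0 := lindley_Iio b
  -- Tails do not see the atom; conservation of total mass under `T` recovers it.
  have hT0 : (T a).real {0} - (T b).real {0} = π₀ := by
    have h1 := huniv a
    have h2 := huniv b
    rw [measureReal_univ_eq hTa0, measureReal_univ_eq ha0] at h1
    rw [measureReal_univ_eq hTb0, measureReal_univ_eq hb0] at h2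
    linarith [hIoi 0 le_rfl, hTIoi 0 le_rfl]
  have h1 : T a + b = T b + a := by
    refine ext_of_singleton_Ioi (by simp [hTa0, hb0]) (by simp [hTb0, ha0]) ?_ fun x hx => ?_
    · rw [measureReal_add_apply, measureReal_add_apply]
      linarith
    · rw [measureReal_add_apply, measureReal_add_apply]
      linarith [hIoi x hx, hTIoi x hx]
  have hbν : (b + ν) (Iio 0) = 0 := by simp [hb0, hν]
  -- Both sides have the same mass by the normalization equation, and `T` fixes both `a - b` and
  -- `ν`, so signed uniqueness applies.
  have h2 : a = b + ν := by
    refine eq_of_lindley_add_eq (prod_expMeasure_compl_ne_zero hμ νB) a (b + ν) ha0 hbν ?_ ?_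
    · rw [← ENNReal.toReal_eq_toReal_iff' (measure_ne_top _ _) (measure_ne_top _ _),
        ← measureReal_def, ← measureReal_def, measureReal_add_apply, probReal_univ (μ := ν),
        measureReal_univ_eq ha0, measureReal_univ_eq hb0]
      linarith [hIoi 0 le_rfl]
    · change T a + (b + ν) = T (b + ν) + a
      rw [hT, lindley_add, ← hT, hfix, ← add_assoc, h1, add_right_comm]
  constructor
  · rw [h2, measureReal_add_apply] at h0
    linarith
  · intro x hx
    have h3 := hIoi x hx
    rw [h2, measureReal_add_apply, add_sub_cancel_left] at h3
    rw [waitingCDF_eq hμ h_decomp hg_int π₀ c hx, ← h3, cdf_eq_real, ← compl_Iic,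
      probReal_compl_eq_one_sub measurableSet_Iic, sub_sub_cancel]

end

end

end LindleyType

theorem mainTheorem1
    {Ω : Type*} [MeasurableSpace Ω] (P : Measure Ω) [IsProbabilityMeasure P]
    (A B W : ℕ → Ω → ℝ)
    (hA_meas : ∀ k, Measurable (A k)) (hB_meas : ∀ k, Measurable (B k))
    (hW_meas : Measurable (W 0)) (hW_nonneg : ∀ᵐ ω ∂P, 0 ≤ W 0 ω)
    (h_indep : iIndepFun (Sum.elim A B) P)
    (μ : ℝ) (hμ : 0 < μ) (hA_law : ∀ k, P.map (A k) = expMeasure μ)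
    (νB : Measure ℝ) [IsProbabilityMeasure νB] (hB_law : ∀ k, P.map (B k) = νB)
    (hB_nonneg : νB (Iio 0) = 0)
    (h_rec : ∀ k ω, W (k + 1) ω = max 0 (B (k + 1) ω - A k ω - W k ω))
    (hB_cont : ContinuousOn (fun x => cdf νB x) (Ici 0))
    (n : ℕ) (g h : Fin n → ℝ → ℝ)
    (h_decomp : LindleyType.TailDecomposition νB g h)
    (hh_bdd : ∀ i, ∃ C : ℝ, ∀ y : ℝ, 0 < y → |h i y| ≤ C)
    (hg_int : ∀ i, IntegrableOn (g i) (Ioi 0)) :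
    -- the integrals in the linear system are well defined
    (IntegrableOn (LindleyType.tail νB) (Ioi 0)
      ∧ (∀ i, IntegrableOn
          (fun x => h i x * LindleyType.expCorrection μ (LindleyType.tail νB) x) (Ioi 0))
      ∧ (∀ i j, IntegrableOn
          (fun x => h i x * LindleyType.expCorrection μ (g j) x) (Ioi 0)))
    -- the linear system has a solution
    ∧ (∃ (π₀ : ℝ) (c : Fin n → ℝ), LindleyType.SolvesSystem μ νB g h π₀ c)
    -- every solution gives the unique stationary law, which is also the limiting law
    ∧ (∃ ν : Measure ℝ,
        LindleyType.IsStationaryLaw (expMeasure μ) νB ν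
        ∧ (∀ ν' : Measure ℝ, LindleyType.IsStationaryLaw (expMeasure μ) νB ν' → ν' = ν)
        ∧ LindleyType.IsLimitingLaw P W ν
        ∧ ∀ (π₀ : ℝ) (c : Fin n → ℝ), LindleyType.SolvesSystem μ νB g h π₀ c →
            ν.real {0} = π₀
            ∧ ∀ x : ℝ, 0 ≤ x → cdf ν x = LindleyType.waitingCDF μ νB g π₀ c x) := by
  have hA_prob := isProbabilityMeasure_expMeasure hμ
  have hρ := LindleyType.prod_expMeasure_compl_ne_zero hμ νB
  obtain ⟨ν, hν_prob, hν, hfix⟩ := LindleyType.exists_lindley_fixed hρ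
  have ht := LindleyType.integrableOn_tail h_decomp hg_int
  refine ⟨⟨ht, fun i => LindleyType.integrableOn_mul_expCorrection hμ
      (LindleyType.measurable_tail νB) ht (h_decomp.measurable_h i) (hh_bdd i),
    fun i j => LindleyType.integrableOn_mul_expCorrection hμ (h_decomp.measurable_g j) (hg_int j)
      (h_decomp.measurable_h i) (hh_bdd i)⟩,
    ⟨_, _, LindleyType.exists_solvesSystem hμ h_decomp hh_bdd hg_int hν hfix⟩,
    ν, ⟨hν_prob, hfix⟩, ?_, ?_, ?_⟩
  · rintro ν' ⟨hν'_prob, hfix'⟩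
    have hfix' : LindleyType.lindley (νB.prod (expMeasure μ)) ν' = ν' := hfix'
    have hν' : ν' (Iio 0) = 0 := by
      rw [← hfix']
      exact LindleyType.lindley_Iio ν'
    exact LindleyType.eq_of_lindley_add_eq hρ ν' ν hν' hν (by simp)
      (by rw [hfix', hfix, add_comm])
  · exact LindleyType.isLimitingLaw_of_lindley_fixed hA_meas hB_meas hW_nonneg h_indep hA_law
      hB_law h_rec hρ hν hfix
  · exact fun π₀ c hS => LindleyType.eq_of_solvesSystem hμ h_decomp hh_bdd hg_int hν hfix hS
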